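/- Let $X\subset\mathbb R^m$ be a bounded convex Borel set (for instance a bounded convex domain), let $\nu,\mu_0,\mu_1$ be Borel probability measures on $X$, and let $|\cdot|$ be the Euclidean norm. Let $\Pi(\mu,\mu')$ be the set of probability measures on $X\times X$ with marginals $\mu$ and $\mu'$, and put $W_2^2(\mu,\mu')=\inf_{\pi\in\Pi(\mu,\mu')}\int|x-x'|^2\,d\pi(x,x')$. Let $\Pi_{opt}(\nu,\mu_i)$ be the set of minimizers of $\int |x_i-y|^2\,d\pi(y,x_i)$ over $\pi\in\Pi(\nu,\mu_i)$. Let $\Gamma$ be the set of probability measures $\gamma$ on $X\times X\times X$, with variables $(y,x_0,x_1)$, whose push-forward under $(y,x_0,x_1)\mapsto(y,x_i)$ belongs to $\Pi_{opt}(\nu,\mu_i)$ for $i=0,1$, and define $$W_\nu(\mu_0,\mu_1)=\sqrt{\inf_{\gamma\in\Gamma}\int|x_0-x_1|^2\,d\gamma(y,x_0,x_1)}.$$ 1. For $\pi_i\in\Pi_{opt}(\nu,\mu_i)$ let $(\mu_i^y)_{y\in X}$ be conditional probabilities of $\pi_i$ given $y$, i.e. a measurable family of probability measures on $X$ with $\pi_i=\nu(y)\otimes\mu_i^y(x)$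 (it is unique up to a $\nu$-null set of $y$). Then $y\mapsto W_2^2(\mu_0^y,\mu_1^y)$ is $\nu$-measurable for all such $\pi_0,\pi_1$, and $$W_\nu^2(\mu_0,\mu_1)=\inf_{\pi_0\in\Pi_{opt}(\nu,\mu_0),\ \pi_1\in\Pi_{opt}(\nu,\mu_1)}\int_X W_2^2(\mu_0^y,\mu_1^y)\,d\nu(y).$$ 2. For $\epsilon>0$ consider the multi-marginal problem of minimizing $$\int_{X\times X\times X}\big[\epsilon|x_0-x_1|^2+|x_0-y|^2+|x_1-y|^2\big]\,d\gamma(y,x_0,x_1)$$ over the probability measures $\gamma$ on $X\times X\times X$ with marginals $\nu,\mu_0,\mu_1$. Let $\gamma_\epsilon$ be minimizers of this problem for values (or a net of values) $\epsilon\to0^+$. Then every weak limit point $\bar\gamma$ of $\gamma_\epsilon$ as $\epsilon\to0^+$, in the topology of weak convergence of probability measures on $X\times X\times X$, is an optimal coupling in the definition of $W_\nu(\mu_0,\mu_1)$: $\bar\gamma\in\Gamma$, and $\bar\gamma$ minimizes $\int|x_0-x_1|^2\,d\gamma$ over $\gamma\in\Gamma$. -/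

import Mathlib

open MeasureTheory ProbabilityTheory Filter Topology
open scoped ENNReal

namespace BaseWasserstein

variable {X : Type*} [MetricSpace X] [MeasurableSpace X]

/-- Transport plans: measures on `X × X` with marginals `μ` and `μ'`.
If `μ` is a probability measure, then so is every plan. -/
def Plans (μ μ' : Measure X) : Set (Measure (X × X)) :=
  {π | π.map (fun p => p.1) = μ ∧ π.map (fun p => p.2) = μ'}

/-- The quadratic transport cost of a plan. -/
noncomputable def quadCost (π : Measure (X × X)) : ℝ≥0∞ :=
  ∫⁻ p, edist p.1 p.2 ^ 2 ∂π

/-- Optimal plans for the quadratic cost. -/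
def OptPlans (μ μ' : Measure X) : Set (Measure (X × X)) :=
  {π | π ∈ Plans μ μ' ∧ ∀ π' ∈ Plans μ μ', quadCost π ≤ quadCost π'}

/-- The quadratic Wasserstein distance. -/
noncomputable def W2 (μ μ' : Measure X) : ℝ≥0∞ :=
  (⨅ π ∈ Plans μ μ', quadCost π) ^ (1 / 2 : ℝ)

/-- Couplings of `ν`, `μ₀`, `μ₁`: measures on triples `(y, x₀, x₁)` with these marginals. -/
def Plans3 (ν μ₀ μ₁ : Measure X) : Set (Measure (X × X × X)) :=
  {γ | γ.map (fun p => p.1) = ν ∧ γ.map (fun p => p.2.1) = μ₀ ∧ γ.map (fun p => p.2.2) = μ₁}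

/-- The competitors for `Wnu ν μ₀ μ₁`: measures on triples `(y, x₀, x₁)` whose projections to
`(y, x₀)` and `(y, x₁)` are optimal plans from `ν` to `μ₀` and from `ν` to `μ₁`. -/
def Competitors (ν μ₀ μ₁ : Measure X) : Set (Measure (X × X × X)) :=
  {γ | γ.map (fun p => (p.1, p.2.1)) ∈ OptPlans ν μ₀ ∧
       γ.map (fun p => (p.1, p.2.2)) ∈ OptPlans ν μ₁}

/-- The integral of `|x₀ - x₁|²` over triples `(y, x₀, x₁)`. -/
noncomputable def nuCost (γ : Measure (X × X × X)) : ℝ≥0∞ :=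
  ∫⁻ p, edist p.2.1 p.2.2 ^ 2 ∂γ

/-- The `ν`-based Wasserstein metric. -/
noncomputable def Wnu (ν μ₀ μ₁ : Measure X) : ℝ≥0∞ :=
  (⨅ γ ∈ Competitors ν μ₀ μ₁, nuCost γ) ^ (1 / 2 : ℝ)

/-- The optimal couplings in the problem that defines `Wnu`. -/
def NuOptimal (ν μ₀ μ₁ : Measure X) : Set (Measure (X × X × X)) :=
  {γ | γ ∈ Competitors ν μ₀ μ₁ ∧ ∀ γ' ∈ Competitors ν μ₀ μ₁, nuCost γ ≤ nuCost γ'}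

/-- The objective of the multi-marginal problem:
the integral of `ε |x₀ - x₁|² + |x₀ - y|² + |x₁ - y|²`. -/
noncomputable def mmCost (ε : ℝ) (γ : Measure (X × X × X)) : ℝ≥0∞ :=
  ∫⁻ p, (ENNReal.ofReal ε * edist p.2.1 p.2.2 ^ 2 + edist p.2.1 p.1 ^ 2
    + edist p.2.2 p.1 ^ 2) ∂γ

/-- The minimizers of the multi-marginal problem with parameter `ε`. -/
def MMOptimal (ε : ℝ) (ν μ₀ μ₁ : Measure X) : Set (Measure (X × X × X)) :=
  {γ | γ ∈ Plans3 ν μ₀ μ₁ ∧ ∀ γ' ∈ Plans3 ν μ₀ μ₁, mmCost ε γ ≤ mmCost ε γ'}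

/-- `κ` is a disintegration `π = ν(y) ⊗ κ y` of a plan `π` with first marginal `ν`: a measurable
family of probability measures `κ y`, the conditional probabilities of `π` given `y`.
It is unique up to a `ν`-null set of `y`. -/
def IsDisintegration (ν : Measure X) (π : Measure (X × X)) (κ : Kernel X X) : Prop :=
  IsMarkovKernel κ ∧ ν ⊗ₘ κ = π

/-- Plans on a Borel set do have disintegrations. -/
theorem exists_isDisintegration [StandardBorelSpace X] {ν μ : Measure X} [IsProbabilityMeasure ν]
    {π : Measure (X × X)} (hπ : π ∈ Plans ν μ) : ∃ κ : Kernel X X, IsDisintegration ν π κ := by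
  have h1 : π.fst = ν := hπ.1
  have : IsProbabilityMeasure π.fst := by rw [h1]; infer_instance
  have : IsProbabilityMeasure π := ⟨by rw [← Measure.fst_univ]; exact measure_univ⟩
  have : Nonempty X := ν.nonempty_of_neZero
  exact ⟨π.condKernel, inferInstance, by rw [← h1]; exact π.disintegrate π.condKernel⟩

end BaseWasserstein

/-! Part 1 is a fiberwise decomposition over `y`. Disintegrating a competitor `γ = ν ⊗ₘ K` gives,
for almost every `y`, a plan `K y` between the conditional probabilities, whence one inequality. For
the other, nearly optimal plans between the conditional probabilities must be chosen measurably in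
`y` and glued.

The selection is made by hand. At scale `1/(n+1)` the space is cut into finitely many cells, and a
rational matrix indexed by pairs of cells defines a density `g` on the product. Where `g` is the
density of a subplan of `κ₀ y` and `κ₁ y`, the missing mass is transported independently; elsewhere
the product plan is used. This gives countably many kernels of plans, and averaging any plan over
the cells shows that the infimum of their costs is `W2 ^ 2` (`exists_kernel_seq_iInf_quadCost`).
Measurability and the selection follow.

In part 2 the objective is `ε * nuCost + baseCost` (`mmCost_eq`). By gluing, the competitors are
exactly the couplings of minimal `baseCost`. Letting `ε → 0` makes the limit minimize `baseCost`;
comparing with a competitor for fixed `ε`, the base costs cancel and `ε` divides out, which makes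
the limit minimize `nuCost`. -/

namespace BaseWasserstein

/-! ### Completing subplans to plans, measurably in a parameter -/

section Measurable

variable {α : Type*} [MeasurableSpace α]

/-- The first marginal of a measure with a density with respect to a product measure. -/
theorem map_fst_withDensity_prod (μ μ' : Measure α) [SFinite μ] [SFinite μ']
    {h : α × α → ℝ≥0∞} (hh : Measurable h) :
    ((μ.prod μ').withDensity h).map (fun p => p.1)
      = μ.withDensity fun x => ∫⁻ x', h (x, x') ∂μ' := by
  ext s hs
  have hst : (fun p : α × α => p.1) ⁻¹' s = s ×ˢ Set.univ := by ext; simp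
  rw [Measure.map_apply measurable_fst hs, withDensity_apply _ (measurable_fst hs),
    withDensity_apply _ hs, hst, ← Measure.prod_restrict, Measure.restrict_univ,
    lintegral_prod _ hh.aemeasurable]

/-- The second marginal of a measure with a density with respect to a product measure. -/
theorem map_snd_withDensity_prod (μ μ' : Measure α) [SFinite μ] [SFinite μ']
    {h : α × α → ℝ≥0∞} (hh : Measurable h) :
    ((μ.prod μ').withDensity h).map (fun p => p.2)
      = μ'.withDensity fun x' => ∫⁻ x, h (x, x') ∂μ := by
  ext s hs
  have hst : (fun p : α × α => p.2) ⁻¹' s = Set.univ ×ˢ s := by ext; simp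
  rw [Measure.map_apply measurable_snd hs, withDensity_apply _ (measurable_snd hs),
    withDensity_apply _ hs, hst, ← Measure.prod_restrict, Measure.restrict_univ,
    lintegral_prod_symm _ hh.aemeasurable]

/-- The density, with respect to `μ × μ'`, of the plan obtained from the subplan with density `g`
by transporting the missing mass independently. -/
noncomputable def completedDensity (μ μ' : Measure α) (g : α × α → ℝ≥0∞) (p : α × α) : ℝ≥0∞ :=
  g p + (1 - ∫⁻ x', g (p.1, x') ∂μ') * (1 - ∫⁻ x, g (x, p.2) ∂μ)
    * (1 - ∫⁻ q, g q ∂(μ.prod μ'))⁻¹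

theorem measurable_completedDensity (μ μ' : Measure α) [SFinite μ] [SFinite μ']
    {g : α × α → ℝ≥0∞} (hg : Measurable g) : Measurable (completedDensity μ μ' g) := by
  have h1 : Measurable fun x => ∫⁻ x', g (x, x') ∂μ' := hg.lintegral_prod_right'
  have h2 : Measurable fun x' => ∫⁻ x, g (x, x') ∂μ := hg.lintegral_prod_left'
  unfold completedDensity
  fun_prop

theorem lintegral_one_sub (μ : Measure α) [IsProbabilityMeasure μ] {u : α → ℝ≥0∞}
    (hu : Measurable u) (h1 : ∀ᵐ x ∂μ, u x ≤ 1) :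
    ∫⁻ x, (1 - u x) ∂μ = 1 - ∫⁻ x, u x ∂μ := by
  have hle : ∫⁻ x, u x ∂μ ≤ 1 := by
    calc ∫⁻ x, u x ∂μ ≤ ∫⁻ _, 1 ∂μ := lintegral_mono_ae h1
      _ = 1 := by simp
  rw [lintegral_sub hu (ne_top_of_le_ne_top ENNReal.one_ne_top hle) h1]
  simp

/-- Marginal densities of the completion have this form, with `t = 1 - ∫ u` the missing mass. If `t
= 0` then `t * t⁻¹ = 0` in `ℝ≥0∞`, but then `u = 1` almost everywhere and nothing has to be added.
-/
theorem one_sub_add_completion (μ : Measure α) [IsProbabilityMeasure μ] {u : α → ℝ≥0∞}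
    (hu : Measurable u) (h1 : ∀ᵐ x ∂μ, u x ≤ 1) :
    ∀ᵐ x ∂μ, u x + (1 - u x) * ((1 - ∫⁻ x, u x ∂μ) * (1 - ∫⁻ x, u x ∂μ)⁻¹) = 1 := by
  by_cases ht : 1 - ∫⁻ x, u x ∂μ = 0
  · rw [← lintegral_one_sub μ hu h1, lintegral_eq_zero_iff (by fun_prop)] at ht
    filter_upwards [ht, h1] with x hx hx1
    have hx : 1 - u x = 0 := hx
    rw [hx, zero_mul, add_zero]
    exact le_antisymm hx1 (tsub_eq_zero_iff_le.1 hx)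
  · filter_upwards [h1] with x hx1
    rw [ENNReal.mul_inv_cancel ht (ne_top_of_le_ne_top ENNReal.one_ne_top tsub_le_self), mul_one,
      add_tsub_cancel_of_le hx1]

variable {μ μ' : Measure α} [IsProbabilityMeasure μ] [IsProbabilityMeasure μ']

theorem lintegral_completedDensity_right {g : α × α → ℝ≥0∞} (hg : Measurable g)
    (hu : ∀ᵐ x ∂μ, ∫⁻ x', g (x, x') ∂μ' ≤ 1) (hv : ∀ᵐ x' ∂μ', ∫⁻ x, g (x, x') ∂μ ≤ 1) :
    ∀ᵐ x ∂μ, ∫⁻ x', completedDensity μ μ' g (x, x') ∂μ' = 1 := by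
  have hum : Measurable fun x => ∫⁻ x', g (x, x') ∂μ' := hg.lintegral_prod_right'
  have hvm : Measurable fun x' => ∫⁻ x, g (x, x') ∂μ := hg.lintegral_prod_left'
  filter_upwards [one_sub_add_completion μ hum hu] with x hx
  simp only [completedDensity]
  rw [lintegral_add_left (by fun_prop), lintegral_mul_const _ (by fun_prop),
    lintegral_const_mul _ (by fun_prop), lintegral_one_sub μ' hvm hv,
    ← lintegral_prod_symm _ hg.aemeasurable, lintegral_prod _ hg.aemeasurable, mul_assoc]
  exact hx

theorem lintegral_completedDensity_left {g : α × α → ℝ≥0∞} (hg : Measurable g)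
    (hu : ∀ᵐ x ∂μ, ∫⁻ x', g (x, x') ∂μ' ≤ 1) (hv : ∀ᵐ x' ∂μ', ∫⁻ x, g (x, x') ∂μ ≤ 1) :
    ∀ᵐ x' ∂μ', ∫⁻ x, completedDensity μ μ' g (x, x') ∂μ = 1 := by
  have hum : Measurable fun x => ∫⁻ x', g (x, x') ∂μ' := hg.lintegral_prod_right'
  have hvm : Measurable fun x' => ∫⁻ x, g (x, x') ∂μ := hg.lintegral_prod_left'
  filter_upwards [one_sub_add_completion μ' hvm hv] with x' hx
  simp only [completedDensity]
  rw [lintegral_add_left (by fun_prop), lintegral_mul_const _ (by fun_prop),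
    lintegral_mul_const _ (by fun_prop), lintegral_one_sub μ hum hu,
    ← lintegral_prod _ hg.aemeasurable, lintegral_prod_symm _ hg.aemeasurable,
    mul_comm (1 - _) (1 - _), mul_assoc]
  exact hx

/-- The added part has mass `t * t * t⁻¹ ≤ t`, where `t` is the missing mass, and each unit of it
costs at most `D`. -/
theorem lintegral_completion_le {g : α × α → ℝ≥0∞} (hg : Measurable g)
    (hu : ∀ᵐ x ∂μ, ∫⁻ x', g (x, x') ∂μ' ≤ 1) (hv : ∀ᵐ x' ∂μ', ∫⁻ x, g (x, x') ∂μ ≤ 1)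
    {c : α × α → ℝ≥0∞} (hc : Measurable c) {D : ℝ≥0∞} (hD : ∀ p, c p ≤ D) :
    ∫⁻ p, c p ∂((μ.prod μ').withDensity (completedDensity μ μ' g))
      ≤ ∫⁻ p, g p * c p ∂(μ.prod μ') + D * (1 - ∫⁻ q, g q ∂(μ.prod μ')) := by
  have hum : Measurable fun x => ∫⁻ x', g (x, x') ∂μ' := hg.lintegral_prod_right'
  have hvm : Measurable fun x' => ∫⁻ x, g (x, x') ∂μ := hg.lintegral_prod_left'
  rw [lintegral_withDensity_eq_lintegral_mul _ (measurable_completedDensity μ μ' hg) hc]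
  set t := 1 - ∫⁻ q, g q ∂(μ.prod μ') with ht
  calc ∫⁻ p, (completedDensity μ μ' g * c) p ∂(μ.prod μ')
      ≤ ∫⁻ p, g p * c p + D * ((1 - ∫⁻ x', g (p.1, x') ∂μ') * (1 - ∫⁻ x, g (x, p.2) ∂μ)
          * t⁻¹) ∂(μ.prod μ') := by
        refine lintegral_mono fun p => ?_
        simp only [Pi.mul_apply, completedDensity, add_mul]
        rw [mul_comm D]
        gcongr
        exact hD p
    _ = ∫⁻ p, g p * c p ∂(μ.prod μ') + D * (t * t * t⁻¹) := by
        rw [lintegral_add_left (by fun_prop), lintegral_const_mul _ (by fun_prop),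
          lintegral_mul_const _ (by fun_prop),
          lintegral_prod_mul (f := fun x => 1 - ∫⁻ x', g (x, x') ∂μ')
            (g := fun x' => 1 - ∫⁻ x, g (x, x') ∂μ) (by fun_prop) (by fun_prop),
          lintegral_one_sub μ hum hu, lintegral_one_sub μ' hvm hv,
          ← lintegral_prod_symm _ hg.aemeasurable, ← lintegral_prod _ hg.aemeasurable]
    _ ≤ ∫⁻ p, g p * c p ∂(μ.prod μ') + D * t := by
        gcongr
        rw [mul_assoc]
        exact mul_le_of_le_one_right' (ENNReal.mul_inv_le_one t)

theorem completion_mem_Plans {g : α × α → ℝ≥0∞} (hg : Measurable g)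
    (hu : ∀ᵐ x ∂μ, ∫⁻ x', g (x, x') ∂μ' ≤ 1) (hv : ∀ᵐ x' ∂μ', ∫⁻ x, g (x, x') ∂μ ≤ 1) :
    (μ.prod μ').withDensity (completedDensity μ μ' g) ∈ Plans μ μ' := by
  have hm := measurable_completedDensity μ μ' hg
  constructor
  · rw [map_fst_withDensity_prod _ _ hm,
      withDensity_congr_ae (g := fun _ => 1) (lintegral_completedDensity_right hg hu hv)]
    exact withDensity_one
  · rw [map_snd_withDensity_prod _ _ hm,
      withDensity_congr_ae (g := fun _ => 1) (lintegral_completedDensity_left hg hu hv)]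
    exact withDensity_one

theorem prod_mem_Plans (μ μ' : Measure α) [IsProbabilityMeasure μ] [IsProbabilityMeasure μ'] :
    μ.prod μ' ∈ Plans μ μ' :=
  ⟨by simp, by simp⟩

theorem isProbabilityMeasure_of_mem_Plans {μ μ' : Measure α} [IsProbabilityMeasure μ]
    {π : Measure (α × α)} (hπ : π ∈ Plans μ μ') : IsProbabilityMeasure π := by
  refine ⟨?_⟩
  rw [← Set.preimage_univ (f := fun p : α × α => p.1),
    ← Measure.map_apply measurable_fst MeasurableSet.univ, hπ.1]
  exact measure_univ

/-- The kernel whose values are the completions of the subplans with density `g`, where `g` is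
the density of a subplan, and the product plans elsewhere. -/
theorem exists_kernel_completion (κ₀ κ₁ : Kernel α α) [IsMarkovKernel κ₀] [IsMarkovKernel κ₁]
    {g : α × α → ℝ≥0∞} (hg : Measurable g) :
    ∃ K : Kernel α (α × α), (∀ y, K y ∈ Plans (κ₀ y) (κ₁ y)) ∧
      ∀ y, (∀ᵐ x ∂κ₀ y, ∫⁻ x', g (x, x') ∂κ₁ y ≤ 1) →
        (∀ᵐ x' ∂κ₁ y, ∫⁻ x, g (x, x') ∂κ₀ y ≤ 1) →
        K y = ((κ₀ y).prod (κ₁ y)).withDensity (completedDensity (κ₀ y) (κ₁ y) g) := by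
  classical
  have hum : Measurable fun q : α × α => ∫⁻ x', g (q.2, x') ∂κ₁ q.1 :=
    Measurable.lintegral_kernel_prod_right (κ := Kernel.comap κ₁ Prod.fst measurable_fst)
      (f := fun (q : α × α) x' => g (q.2, x')) (by unfold Function.uncurry; fun_prop)
  have hvm : Measurable fun q : α × α => ∫⁻ x, g (x, q.2) ∂κ₀ q.1 :=
    Measurable.lintegral_kernel_prod_right (κ := Kernel.comap κ₀ Prod.fst measurable_fst)
      (f := fun (q : α × α) x => g (x, q.2)) (by unfold Function.uncurry; fun_prop)
  have htm : Measurable fun y => ∫⁻ q, g q ∂((κ₀ y).prod (κ₁ y)) := by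
    have := hg.lintegral_kernel (κ := κ₀ ×ₖ κ₁)
    simpa only [Kernel.prod_apply] using this
  have hdm : Measurable (Function.uncurry fun y => completedDensity (κ₀ y) (κ₁ y) g) := by
    have h1 : Measurable fun q : α × α × α => ∫⁻ x', g (q.2.1, x') ∂κ₁ q.1 :=
      hum.comp (measurable_fst.prodMk measurable_snd.fst)
    have h2 : Measurable fun q : α × α × α => ∫⁻ x, g (x, q.2.2) ∂κ₀ q.1 :=
      hvm.comp (measurable_fst.prodMk measurable_snd.snd)
    unfold Function.uncurry completedDensity
    have h3 : Measurable fun q : α × α × α => ∫⁻ p, g p ∂((κ₀ q.1).prod (κ₁ q.1)) :=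
      htm.comp measurable_fst
    fun_prop
  -- Each almost-everywhere condition says that a kernel gives mass zero to a measurable bad set
  -- depending measurably on `y`.
  have hS : MeasurableSet {y | (∀ᵐ x ∂κ₀ y, ∫⁻ x', g (x, x') ∂κ₁ y ≤ 1) ∧
      ∀ᵐ x' ∂κ₁ y, ∫⁻ x, g (x, x') ∂κ₀ y ≤ 1} := by
    refine MeasurableSet.inter ?_ ?_
    · exact measurableSet_eq_fun (Kernel.measurable_kernel_prodMk_left (κ := κ₀)
        (measurableSet_le hum measurable_const).compl) measurable_const
    · exact measurableSet_eq_fun (Kernel.measurable_kernel_prodMk_left (κ := κ₁)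
        (measurableSet_le hvm measurable_const).compl) measurable_const
  refine ⟨Kernel.piecewise hS
    (Kernel.withDensity (κ₀ ×ₖ κ₁) fun y => completedDensity (κ₀ y) (κ₁ y) g) (κ₀ ×ₖ κ₁), ?_, ?_⟩
  · intro y
    rw [Kernel.piecewise_apply]
    split_ifs with hy
    · rw [Kernel.withDensity_apply _ hdm, Kernel.prod_apply]
      exact completion_mem_Plans hg hy.1 hy.2
    · rw [Kernel.prod_apply]
      exact prod_mem_Plans _ _
  · intro y h1 h2
    rw [Kernel.piecewise_apply, if_pos ⟨h1, h2⟩, Kernel.withDensity_apply _ hdm, Kernel.prod_apply]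

end Measurable

/-! ### Averaging a plan over finitely many cells -/

section Cells

variable {α ι : Type*} [MeasurableSpace α] [Fintype ι] [MeasurableSpace ι]
  [MeasurableSingletonClass ι]

theorem lintegral_cells (μ : Measure α) {c : α → ι} (hc : Measurable c) (f : ι → ℝ≥0∞) :
    ∫⁻ x, f (c x) ∂μ = ∑ i, f i * μ (c ⁻¹' {i}) := by
  rw [← lintegral_map (measurable_of_finite f) hc, lintegral_fintype]
  simp_rw [Measure.map_apply hc (measurableSet_singleton _)]

theorem lintegral_cells_prod (π : Measure (α × α)) {c : α → ι} (hc : Measurable c)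
    (f : ι → ι → ℝ≥0∞) :
    ∫⁻ p, f (c p.1) (c p.2) ∂π = ∑ i, ∑ j, f i j * π ((c ⁻¹' {i}) ×ˢ (c ⁻¹' {j})) := by
  have hcc : Measurable fun p : α × α => (c p.1, c p.2) := by fun_prop
  rw [lintegral_cells π hcc fun q => f q.1 q.2, Fintype.sum_prod_type]
  refine Finset.sum_congr rfl fun i _ => Finset.sum_congr rfl fun j _ => ?_
  congr 2
  ext p
  simp

/-- Rational values keep the family of densities countable; approximation from below preserves the
subplan constraints. -/
theorem exists_rat_le_and_le_add {x η : ℝ≥0∞} (hx : x ≠ ⊤) (hη : η ≠ 0) :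
    ∃ r : ℚ, ((Real.toNNReal r : NNReal) : ℝ≥0∞) ≤ x ∧
      x ≤ ((Real.toNNReal r : NNReal) : ℝ≥0∞) + η := by
  rcases eq_or_ne x 0 with rfl | h0
  · exact ⟨0, by simp, by simp⟩
  · obtain ⟨r, -, h1, h2⟩ := ENNReal.lt_iff_exists_rat_btwn.1 (ENNReal.sub_lt_self hx h0 hη)
    exact ⟨r, h2.le, tsub_le_iff_right.1 h1.le⟩

/-- The cells of a plan carry a subplan whose density with respect to the product of the marginals
is constant on the products of cells, with rational values. -/
theorem exists_rat_subplan_density {μ μ' : Measure α} [IsProbabilityMeasure μ]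
    [IsProbabilityMeasure μ'] {π : Measure (α × α)} (h1 : π.map (fun p => p.1) = μ)
    (h2 : π.map (fun p => p.2) = μ') {c : α → ι} (hc : Measurable c) {C : α × α → ℝ≥0∞}
    {ε η : ℝ≥0∞} (hη : η ≠ 0)
    (hC : ∀ p q : α × α, c p.1 = c q.1 → c p.2 = c q.2 → C p ≤ C q + ε) :
    ∃ r : ι → ι → ℚ, ∃ g : α × α → ℝ≥0∞,
      (g = fun p => ((Real.toNNReal (r (c p.1) (c p.2)) : NNReal) : ℝ≥0∞)) ∧
      (∀ x, ∫⁻ x', g (x, x') ∂μ' ≤ 1) ∧ (∀ x', ∫⁻ x, g (x, x') ∂μ ≤ 1) ∧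
      ∫⁻ p, g p * C p ∂(μ.prod μ') ≤ ∫⁻ p, C p ∂π + ε ∧
      1 - ∫⁻ p, g p ∂(μ.prod μ') ≤ η := by
  classical
  have hπ : π Set.univ = 1 := by
    rw [← Set.preimage_univ (f := fun p : α × α => p.1),
      ← Measure.map_apply measurable_fst MeasurableSet.univ, h1, measure_univ]
  set a : ι → ℝ≥0∞ := fun i => μ (c ⁻¹' {i}) with ha
  set b : ι → ℝ≥0∞ := fun j => μ' (c ⁻¹' {j}) with hb
  set P : ι → ι → ℝ≥0∞ := fun i j => π ((c ⁻¹' {i}) ×ˢ (c ⁻¹' {j})) with hP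
  -- The density of the averaged plan, which spreads the mass `P i j` over a product of cells
  -- proportionally to `μ.prod μ'`. On null products it is `0 / 0 = 0`.
  set q : ι → ι → ℝ≥0∞ := fun i j => P i j / (a i * b j) with hq
  have hrow : ∀ i, ∑ j, P i j = a i := by
    intro i
    have e1 := lintegral_cells_prod π hc fun i' _ => if i' = i then 1 else 0
    have e2 := lintegral_cells μ hc fun i' => if i' = i then 1 else 0
    have e3 := lintegral_map (μ := π)
      ((measurable_of_finite fun i' => if i' = i then (1 : ℝ≥0∞) else 0).comp hc) measurable_fst
    rw [h1] at e3
    have e4 := e1.symm.trans (e3.symm.trans e2)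
    simpa [ha, hP] using e4
  have hcol : ∀ j, ∑ i, P i j = b j := by
    intro j
    have e1 := lintegral_cells_prod π hc fun _ j' => if j' = j then 1 else 0
    have e2 := lintegral_cells μ' hc fun i' => if i' = j then 1 else 0
    have e3 := lintegral_map (μ := π)
      ((measurable_of_finite fun i' => if i' = j then (1 : ℝ≥0∞) else 0).comp hc) measurable_snd
    rw [h2] at e3
    have e4 := e1.symm.trans (e3.symm.trans e2)
    simpa [hb, hP] using e4
  have hPa : ∀ i j, P i j ≤ a i := fun i j =>
    (hrow i) ▸ Finset.single_le_sum (f := fun j => P i j) (fun _ _ => zero_le) (Finset.mem_univ j)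
  have hPb : ∀ i j, P i j ≤ b j := fun i j =>
    (hcol j) ▸ Finset.single_le_sum (f := fun i => P i j) (fun _ _ => zero_le) (Finset.mem_univ i)
  have hqab : ∀ i j, q i j * (a i * b j) = P i j := by
    intro i j
    refine ENNReal.div_mul_cancel' (fun h0 => ?_) (fun ht => ?_)
    · rcases mul_eq_zero.1 h0 with h | h
      · exact le_antisymm (h ▸ hPa i j) zero_le
      · exact le_antisymm (h ▸ hPb i j) zero_le
    · exact absurd ht (ENNReal.mul_ne_top (measure_ne_top _ _) (measure_ne_top _ _))
  have hqtop : ∀ i j, q i j ≠ ⊤ := by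
    intro i j
    rcases eq_or_ne (P i j) 0 with h0 | h0
    · simp [hq, h0]
    · refine ENNReal.div_ne_top (ne_top_of_le_ne_top (measure_ne_top μ _) (hPa i j))
        (mul_ne_zero (fun h => h0 ?_) fun h => h0 ?_)
      · exact le_antisymm (h ▸ hPa i j) zero_le
      · exact le_antisymm (h ▸ hPb i j) zero_le
  have hqrow : ∀ i, ∑ j, q i j * b j ≤ 1 := by
    intro i
    calc ∑ j, q i j * b j ≤ ∑ j, P i j / a i := by
          refine Finset.sum_le_sum fun j _ => ?_
          rcases eq_or_ne (P i j) 0 with h0 | h0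
          · simp [hq, h0]
          rw [ENNReal.le_div_iff_mul_le, mul_assoc, mul_comm (b j), hqab]
          · exact Or.inr h0
          · exact Or.inl (measure_ne_top _ _)
      _ = a i / a i := by simp_rw [div_eq_mul_inv, ← Finset.sum_mul, hrow]
      _ ≤ 1 := ENNReal.div_self_le_one
  have hqcol : ∀ j, ∑ i, q i j * a i ≤ 1 := by
    intro j
    calc ∑ i, q i j * a i ≤ ∑ i, P i j / b j := by
          refine Finset.sum_le_sum fun i _ => ?_
          rcases eq_or_ne (P i j) 0 with h0 | h0
          · simp [hq, h0]
          rw [ENNReal.le_div_iff_mul_le, mul_assoc, hqab]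
          · exact Or.inr h0
          · exact Or.inl (measure_ne_top _ _)
      _ = b j / b j := by simp_rw [div_eq_mul_inv, ← Finset.sum_mul, hcol]
      _ ≤ 1 := ENNReal.div_self_le_one
  -- The averaged plan and `π` agree on functions that are constant on products of cells.
  have hint : ∀ f : ι → ι → ℝ≥0∞,
      ∫⁻ p, f (c p.1) (c p.2) * q (c p.1) (c p.2) ∂(μ.prod μ') = ∫⁻ p, f (c p.1) (c p.2) ∂π := by
    intro f
    rw [lintegral_cells_prod _ hc fun i j => f i j * q i j, lintegral_cells_prod _ hc f]
    simp_rw [Measure.prod_prod, mul_assoc]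
    refine Finset.sum_congr rfl fun i _ => Finset.sum_congr rfl fun j _ => ?_
    rw [hqab]
  choose r hr1 hr2 using fun i j => exists_rat_le_and_le_add (hqtop i j) hη
  refine ⟨r, _, rfl, fun x => ?_, fun x' => ?_, ?_, ?_⟩
  · calc _ ≤ ∫⁻ x', q (c x) (c x') ∂μ' := lintegral_mono fun _ => hr1 _ _
      _ = ∑ j, q (c x) j * b j := lintegral_cells μ' hc (q (c x))
      _ ≤ 1 := hqrow _
  · calc _ ≤ ∫⁻ x, q (c x) (c x') ∂μ := lintegral_mono fun _ => hr1 _ _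
      _ = ∑ i, q i (c x') * a i := lintegral_cells μ hc (fun i => q i (c x'))
      _ ≤ 1 := hqcol _
  -- Replacing `C` by its supremum over each product of cells makes it constant there, so `hint`
  -- applies; the oscillation bound `hC` then returns to `C` at the price of `ε`.
  · set S : ι → ι → ℝ≥0∞ := fun i j => ⨆ p : {p : α × α // c p.1 = i ∧ c p.2 = j}, C p
    calc _ ≤ ∫⁻ p, S (c p.1) (c p.2) * q (c p.1) (c p.2) ∂(μ.prod μ') := by
          refine lintegral_mono fun p => ?_
          dsimp only
          rw [mul_comm]
          gcongr
          · exact le_iSup (fun p' : {p' : α × α // c p'.1 = c p.1 ∧ c p'.2 = c p.2} => C p')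
              ⟨p, rfl, rfl⟩
          · exact hr1 _ _
      _ = ∫⁻ p, S (c p.1) (c p.2) ∂π := hint S
      _ ≤ ∫⁻ p, C p + ε ∂π := lintegral_mono fun p => iSup_le fun p' => hC _ _ p'.2.1 p'.2.2
      _ = ∫⁻ p, C p ∂π + ε := by
          rw [lintegral_add_right _ measurable_const, lintegral_const, hπ, mul_one]
  · rw [tsub_le_iff_left]
    calc (1 : ℝ≥0∞) = ∫⁻ p, q (c p.1) (c p.2) ∂(μ.prod μ') := by
          have := hint fun _ _ => 1
          simpa [hπ] using this.symm
      _ ≤ ∫⁻ p, ((Real.toNNReal (r (c p.1) (c p.2)) : NNReal) : ℝ≥0∞) + η ∂(μ.prod μ') :=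
          lintegral_mono fun _ => hr2 _ _
      _ = _ := by
          rw [lintegral_add_right _ measurable_const, lintegral_const, measure_univ, mul_one]

end Cells

/-! ### The Wasserstein distance of kernel values as a countable infimum -/

section Metric

variable {X : Type*} [MetricSpace X]

/-- Expansion of `(s + 2δ)²` with `s ≤ D`; since `δ ≤ 1`, the term `4δ²` is at most `4δ`. -/
theorem edist_sq_le_add {D δ : ℝ≥0∞} (hδ : δ ≤ 1) (hD : ∀ x x' : X, edist x x' ≤ D)
    {x x' z z' : X} (h : edist x z ≤ δ) (h' : edist x' z' ≤ δ) :
    edist x x' ^ 2 ≤ edist z z' ^ 2 + (4 * D + 4) * δ := by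
  have h1 : edist x x' ≤ edist z z' + 2 * δ := by
    calc edist x x' ≤ edist x z + edist z z' + edist z' x' := edist_triangle4 _ _ _ _
      _ ≤ δ + edist z z' + δ := by gcongr; rwa [edist_comm]
      _ = _ := by ring
  calc edist x x' ^ 2 ≤ (edist z z' + 2 * δ) ^ 2 := by gcongr
    _ = edist z z' ^ 2 + (4 * edist z z' + 4 * δ) * δ := by ring
    _ ≤ _ := by gcongr; exacts [hD _ _, mul_le_of_le_one_right' hδ]

variable [MeasurableSpace X]

/-- A point is labelled by the set of balls of a finite `δ / 2`-cover that contain it. Points with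
equal labels share a ball, and the balls need not be made disjoint. -/
theorem exists_measurable_cells [OpensMeasurableSpace X] (hX : TotallyBounded (Set.univ : Set X))
    {δ : ℝ≥0∞} (hδ : δ ≠ 0) :
    ∃ N : ℕ, ∃ c : X → (Fin N → Prop), Measurable c ∧ ∀ x x', c x = c x' → edist x x' ≤ δ := by
  obtain ⟨t, ht, hcov⟩ := EMetric.totallyBounded_iff.1 hX (δ / 2) (ENNReal.half_pos hδ)
  obtain ⟨N, e, -, rfl⟩ := ht.fin_param
  refine ⟨N, fun x i => x ∈ Metric.eball (e i) (δ / 2),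
    measurable_pi_lambda _ fun i => Metric.isOpen_eball.measurableSet.mem, fun x x' h => ?_⟩
  obtain ⟨_, ⟨i, rfl⟩, hi⟩ := Set.mem_iUnion₂.1 (hcov (Set.mem_univ x))
  have hi' : x' ∈ Metric.eball (e i) (δ / 2) := (congrFun h i).mp hi
  calc edist x x' ≤ edist x (e i) + edist (e i) x' := edist_triangle _ _ _
    _ ≤ δ / 2 + δ / 2 := by
        gcongr
        · exact (Metric.mem_eball.1 hi).le
        · rw [edist_comm]; exact (Metric.mem_eball.1 hi').le
    _ = δ := ENNReal.add_halves δ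

theorem measurable_quadCost_kernel [SecondCountableTopology X] [OpensMeasurableSpace X]
    (K : Kernel X (X × X)) : Measurable fun y => quadCost (K y) :=
  Measurable.lintegral_kernel (κ := K) (by fun_prop)

theorem quadCost_le [SecondCountableTopology X] {D : ℝ≥0∞} (hD : ∀ x x' : X, edist x x' ≤ D)
    (π : Measure (X × X)) [IsProbabilityMeasure π] : quadCost π ≤ D ^ 2 := by
  calc quadCost π ≤ ∫⁻ _, D ^ 2 ∂π := lintegral_mono fun p => by gcongr; exact hD _ _
    _ = D ^ 2 := by simp

theorem W2_sq (μ μ' : Measure X) : W2 μ μ' ^ 2 = ⨅ π ∈ Plans μ μ', quadCost π := by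
  rw [W2, ← ENNReal.rpow_natCast, ← ENNReal.rpow_mul]
  norm_num

theorem Wnu_sq (ν μ μ' : Measure X) :
    Wnu ν μ μ' ^ 2 = ⨅ γ ∈ Competitors ν μ μ', nuCost γ := by
  rw [Wnu, ← ENNReal.rpow_natCast, ← ENNReal.rpow_mul]
  norm_num

/-- Countably many kernels with values in the plans realize the Wasserstein distance between the
values of two kernels as the infimum of their costs. -/
theorem exists_kernel_seq_iInf_quadCost [SecondCountableTopology X] [OpensMeasurableSpace X]
    (hX : TotallyBounded (Set.univ : Set X)) {D : ℝ≥0∞} (hDtop : D ≠ ⊤)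
    (hD : ∀ x x' : X, edist x x' ≤ D)
    (κ₀ κ₁ : Kernel X X) [IsMarkovKernel κ₀] [IsMarkovKernel κ₁] :
    ∃ K : ℕ → Kernel X (X × X), (∀ n y, K n y ∈ Plans (κ₀ y) (κ₁ y)) ∧
      ∀ y, ⨅ n, quadCost (K n y) = W2 (κ₀ y) (κ₁ y) ^ 2 := by
  choose N c hcm hc using fun n : ℕ => exists_measurable_cells (X := X) hX
    (δ := ((n : ℝ≥0∞) + 1)⁻¹) (by simp)
  -- A scale and a rational matrix on pairs of cells: a countable index set independent of `y`.
  let I := Σ n, (Fin (N n) → Prop) → (Fin (N n) → Prop) → ℚ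
  let g : I → X × X → ℝ≥0∞ := fun i p =>
    ((Real.toNNReal (i.2 (c i.1 p.1) (c i.1 p.2)) : NNReal) : ℝ≥0∞)
  have hg : ∀ i, Measurable (g i) := by
    intro i
    have h1 : Measurable fun p : X × X => (c i.1 p.1, c i.1 p.2) :=
      ((hcm i.1).comp measurable_fst).prodMk ((hcm i.1).comp measurable_snd)
    exact (measurable_of_finite
      fun q : (Fin (N i.1) → Prop) × (Fin (N i.1) → Prop) =>
        ((Real.toNNReal (i.2 q.1 q.2) : NNReal) : ℝ≥0∞)).comp h1
  choose K hK1 hK2 using fun i => exists_kernel_completion κ₀ κ₁ (hg i)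
  have : Nonempty I := ⟨⟨0, fun _ _ => 0⟩⟩
  obtain ⟨s, hs⟩ := exists_surjective_nat I
  refine ⟨fun n => K (s n), fun n => hK1 (s n), fun y => ?_⟩
  rw [hs.iInf_comp (fun i => quadCost (K i y)), W2_sq]
  refine le_antisymm (le_iInf₂ fun π hπ => ?_) (le_iInf fun i => iInf₂_le _ (hK1 i y))
  -- `4 * D + 4` pays for the oscillation of the cost on cells, `D ^ 2` for the mass lost in
  -- rounding to rationals.
  set B : ℝ≥0∞ := (4 * D + 4) + D ^ 2 with hB
  have hkey : ∀ n : ℕ, ⨅ i, quadCost (K i y) ≤ quadCost π + B * ((n : ℝ≥0∞) + 1)⁻¹ := by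
    intro n
    have hδ : ((n : ℝ≥0∞) + 1)⁻¹ ≤ 1 := ENNReal.inv_le_one.2 (by simp)
    obtain ⟨r, g', hg', hu, hv, hcost, hmass⟩ := exists_rat_subplan_density hπ.1 hπ.2 (hcm n)
      (C := fun p => edist p.1 p.2 ^ 2) (ε := (4 * D + 4) * ((n : ℝ≥0∞) + 1)⁻¹)
      (η := ((n : ℝ≥0∞) + 1)⁻¹) (by simp)
      fun p q h1 h2 => edist_sq_le_add hδ hD (hc n _ _ h1) (hc n _ _ h2)
    have hgi : g ⟨n, r⟩ = g' := hg'.symm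
    refine (iInf_le _ ⟨n, r⟩).trans ?_
    rw [hK2 ⟨n, r⟩ y (by rw [hgi]; exact ae_of_all _ hu) (by rw [hgi]; exact ae_of_all _ hv), hgi]
    refine (lintegral_completion_le (hgi ▸ hg ⟨n, r⟩) (ae_of_all _ hu) (ae_of_all _ hv)
      (by fun_prop) (D := D ^ 2) fun p => by gcongr; exact hD _ _).trans ?_
    calc _ ≤ (∫⁻ p, edist p.1 p.2 ^ 2 ∂π + (4 * D + 4) * ((n : ℝ≥0∞) + 1)⁻¹)
          + D ^ 2 * ((n : ℝ≥0∞) + 1)⁻¹ := by gcongr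
      _ = _ := by rw [hB, quadCost]; ring
  have hlim : Tendsto (fun n : ℕ => quadCost π + B * ((n : ℝ≥0∞) + 1)⁻¹) atTop
      (𝓝 (quadCost π + B * 0)) := by
    refine Tendsto.add tendsto_const_nhds (ENNReal.Tendsto.const_mul ?_ (Or.inr ?_))
    · have := (tendsto_add_atTop_iff_nat 1).2 ENNReal.tendsto_inv_nat_nhds_zero
      simpa using this
    · finiteness
  rw [mul_zero, add_zero] at hlim
  exact ge_of_tendsto' hlim hkey

end Metric

/-! ### Gluing and disintegrating couplings -/

section Gluing

variable {α : Type*} [MeasurableSpace α]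

theorem map_fst_compProd_kernel (ν : Measure α) [SFinite ν] (K : Kernel α (α × α))
    [IsSFiniteKernel K] :
    (ν ⊗ₘ K).map (fun p => (p.1, p.2.1)) = ν ⊗ₘ K.map (fun q => q.1) :=
  (Measure.compProd_map measurable_fst).symm

theorem map_snd_compProd_kernel (ν : Measure α) [SFinite ν] (K : Kernel α (α × α))
    [IsSFiniteKernel K] :
    (ν ⊗ₘ K).map (fun p => (p.1, p.2.2)) = ν ⊗ₘ K.map (fun q => q.2) :=
  (Measure.compProd_map measurable_snd).symm

theorem isMarkovKernel_of_mem_Plans {κ₀ κ₁ : Kernel α α} [IsMarkovKernel κ₀]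
    {K : Kernel α (α × α)} (hK : ∀ y, K y ∈ Plans (κ₀ y) (κ₁ y)) : IsMarkovKernel K :=
  ⟨fun y => isProbabilityMeasure_of_mem_Plans (hK y)⟩

/-- Gluing along a kernel of plans between conditional probabilities. -/
theorem map_compProd_of_mem_Plans {ν : Measure α} [SFinite ν] {π₀ π₁ : Measure (α × α)}
    {κ₀ κ₁ : Kernel α α} (h₀ : IsDisintegration ν π₀ κ₀) (h₁ : IsDisintegration ν π₁ κ₁)
    {K : Kernel α (α × α)} (hK : ∀ y, K y ∈ Plans (κ₀ y) (κ₁ y)) :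
    (ν ⊗ₘ K).map (fun p => (p.1, p.2.1)) = π₀ ∧ (ν ⊗ₘ K).map (fun p => (p.1, p.2.2)) = π₁ := by
  have := h₀.1
  have := isMarkovKernel_of_mem_Plans hK
  have e₀ : K.map (fun q => q.1) = κ₀ := by
    ext1 y; rw [Kernel.map_apply _ measurable_fst, (hK y).1]
  have e₁ : K.map (fun q => q.2) = κ₁ := by
    ext1 y; rw [Kernel.map_apply _ measurable_snd, (hK y).2]
  rw [map_fst_compProd_kernel, map_snd_compProd_kernel, e₀, e₁]
  exact ⟨h₀.2, h₁.2⟩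

theorem mem_Plans3_iff {ν μ₀ μ₁ : Measure α} {γ : Measure (α × α × α)} :
    γ ∈ Plans3 ν μ₀ μ₁ ↔ γ.map (fun p => (p.1, p.2.1)) ∈ Plans ν μ₀ ∧
      γ.map (fun p => (p.1, p.2.2)) ∈ Plans ν μ₁ := by
  have m0 : Measurable fun p : α × α × α => (p.1, p.2.1) := by fun_prop
  have m1 : Measurable fun p : α × α × α => (p.1, p.2.2) := by fun_prop
  simp only [Plans3, Plans, Set.mem_ofPred_eq, Measure.map_map measurable_fst m0,
    Measure.map_map measurable_snd m0, Measure.map_map measurable_fst m1,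
    Measure.map_map measurable_snd m1, Function.comp_def]
  tauto

/-- Almost every conditional measure of a coupling is a plan between the conditional
probabilities of its projections. -/
theorem exists_disintegration_mem_Plans [StandardBorelSpace α] {ν μ₀ μ₁ : Measure α}
    [IsProbabilityMeasure ν] {γ : Measure (α × α × α)} (hγ : γ ∈ Plans3 ν μ₀ μ₁)
    {κ₀ κ₁ : Kernel α α} (h₀ : IsDisintegration ν (γ.map fun p => (p.1, p.2.1)) κ₀)
    (h₁ : IsDisintegration ν (γ.map fun p => (p.1, p.2.2)) κ₁) :
    ∃ K : Kernel α (α × α), IsMarkovKernel K ∧ ν ⊗ₘ K = γ ∧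
      ∀ᵐ y ∂ν, K y ∈ Plans (κ₀ y) (κ₁ y) := by
  have hfst : γ.fst = ν := hγ.1
  have : IsProbabilityMeasure γ :=
    ⟨by rw [← Measure.fst_univ, hfst]; exact measure_univ⟩
  have : Nonempty α := ν.nonempty_of_neZero
  have := h₀.1
  have := h₁.1
  have hK : ν ⊗ₘ γ.condKernel = γ := by
    conv_lhs => rw [← hfst]
    exact γ.disintegrate γ.condKernel
  have e₀ := map_fst_compProd_kernel ν γ.condKernel
  have e₁ := map_snd_compProd_kernel ν γ.condKernel
  rw [hK, ← h₀.2] at e₀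
  rw [hK, ← h₁.2] at e₁
  refine ⟨γ.condKernel, inferInstance, hK, ?_⟩
  -- The marginals of `γ.condKernel` disintegrate the projections of `γ`; disintegrations are unique
  -- almost everywhere.
  filter_upwards [Kernel.ae_eq_of_compProd_eq e₀, Kernel.ae_eq_of_compProd_eq e₁] with y h0 h1
  rw [Kernel.map_apply _ measurable_fst] at h0
  rw [Kernel.map_apply _ measurable_snd] at h1
  exact ⟨h0.symm, h1.symm⟩

end Gluing

/-! ### Measurable selection and the fiberwise formula -/

section Metric

variable {X : Type*} [MetricSpace X] [MeasurableSpace X]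

/-- The two projections are made conditionally independent given `y`. Thus one projection of a
coupling can be changed while the other is kept. -/
theorem exists_glued_plan [StandardBorelSpace X] {ν μ₀ μ₁ : Measure X} [IsProbabilityMeasure ν]
    {π₀ π₁ : Measure (X × X)} (h₀ : π₀ ∈ Plans ν μ₀) (h₁ : π₁ ∈ Plans ν μ₁) :
    ∃ γ : Measure (X × X × X), γ.map (fun p => (p.1, p.2.1)) = π₀ ∧
      γ.map (fun p => (p.1, p.2.2)) = π₁ := by
  obtain ⟨κ₀, hκ₀⟩ := exists_isDisintegration h₀
  obtain ⟨κ₁, hκ₁⟩ := exists_isDisintegration h₁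
  have := hκ₀.1
  have := hκ₁.1
  exact ⟨ν ⊗ₘ (κ₀ ×ₖ κ₁), map_compProd_of_mem_Plans hκ₀ hκ₁ fun y => by
    rw [Kernel.prod_apply]; exact prod_mem_Plans _ _⟩

theorem Competitors_subset_Plans3 (ν μ₀ μ₁ : Measure X) :
    Competitors ν μ₀ μ₁ ⊆ Plans3 ν μ₀ μ₁ :=
  fun _ h => mem_Plans3_iff.2 ⟨h.1.1, h.2.1⟩

variable [SecondCountableTopology X] [OpensMeasurableSpace X]

/-- Measurable selection of nearly optimal plans between the values of two kernels. -/
theorem exists_kernel_quadCost_le (hX : TotallyBounded (Set.univ : Set X)) {D : ℝ≥0∞}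
    (hDtop : D ≠ ⊤) (hD : ∀ x x' : X, edist x x' ≤ D) (κ₀ κ₁ : Kernel X X) [IsMarkovKernel κ₀]
    [IsMarkovKernel κ₁] {δ : ℝ≥0∞} (hδ : δ ≠ 0) :
    ∃ K : Kernel X (X × X), (∀ y, K y ∈ Plans (κ₀ y) (κ₁ y)) ∧
      ∀ y, quadCost (K y) ≤ W2 (κ₀ y) (κ₁ y) ^ 2 + δ := by
  classical
  obtain ⟨K, hK, hinf⟩ := exists_kernel_seq_iInf_quadCost hX hDtop hD κ₀ κ₁
  have hex : ∀ y, ∃ n, quadCost (K n y) < (⨅ n, quadCost (K n y)) + δ := by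
    intro y
    have := isProbabilityMeasure_of_mem_Plans (hK 0 y)
    refine iInf_lt_iff.1 (ENNReal.lt_add_right (ne_top_of_le_ne_top ?_ (iInf_le _ 0)) hδ)
    exact ne_top_of_le_ne_top (by finiteness) (quadCost_le hD (K 0 y))
  have hm : ∀ n, Measurable fun y => quadCost (K n y) := fun n => measurable_quadCost_kernel (K n)
  -- The first index whose cost is within `δ` of the infimum depends measurably on `y`.
  refine ⟨⟨fun y => K (Nat.find (hex y)) y, ?_⟩, fun y => hK _ y, fun y => ?_⟩
  · exact Measurable.find (fun n => (K n).measurable)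
      (fun n => measurableSet_lt (hm n) ((Measurable.iInf hm).add_const δ)) hex
  · rw [← hinf y]
    exact (Nat.find_spec (hex y)).le

theorem measurable_W2_sq (hX : TotallyBounded (Set.univ : Set X)) {D : ℝ≥0∞}
    (hDtop : D ≠ ⊤) (hD : ∀ x x' : X, edist x x' ≤ D) (κ₀ κ₁ : Kernel X X) [IsMarkovKernel κ₀]
    [IsMarkovKernel κ₁] : Measurable fun y => W2 (κ₀ y) (κ₁ y) ^ 2 := by
  obtain ⟨K, -, hinf⟩ := exists_kernel_seq_iInf_quadCost hX hDtop hD κ₀ κ₁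
  simp_rw [← hinf]
  exact Measurable.iInf fun n => measurable_quadCost_kernel (K n)

theorem nuCost_compProd (ν : Measure X) [SFinite ν] (K : Kernel X (X × X)) [IsSFiniteKernel K] :
    nuCost (ν ⊗ₘ K) = ∫⁻ y, quadCost (K y) ∂ν :=
  Measure.lintegral_compProd (f := fun p : X × X × X => edist p.2.1 p.2.2 ^ 2) (by fun_prop)

/-- For `≤`, nearly optimal plans between the conditional probabilities are glued into a competitor;
for `≥`, a competitor is disintegrated into such plans. -/
theorem Wnu_sq_eq_iInf_lintegral_W2_sq [StandardBorelSpace X]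
    (hX : TotallyBounded (Set.univ : Set X)) {D : ℝ≥0∞} (hDtop : D ≠ ⊤)
    (hD : ∀ x x' : X, edist x x' ≤ D) (ν μ₀ μ₁ : Measure X) [IsProbabilityMeasure ν]
    {κ₀ κ₁ : Measure (X × X) → Kernel X X}
    (h₀ : ∀ π ∈ OptPlans ν μ₀, IsDisintegration ν π (κ₀ π))
    (h₁ : ∀ π ∈ OptPlans ν μ₁, IsDisintegration ν π (κ₁ π)) :
    Wnu ν μ₀ μ₁ ^ 2 = ⨅ π₀ ∈ OptPlans ν μ₀, ⨅ π₁ ∈ OptPlans ν μ₁,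
      ∫⁻ y, W2 (κ₀ π₀ y) (κ₁ π₁ y) ^ 2 ∂ν := by
  rw [Wnu_sq]
  refine le_antisymm (le_iInf₂ fun π₀ hπ₀ => le_iInf₂ fun π₁ hπ₁ => ?_)
    (le_iInf₂ fun γ hγ => ?_)
  · have := (h₀ π₀ hπ₀).1
    have := (h₁ π₁ hπ₁).1
    refine ENNReal.le_of_forall_pos_le_add fun δ hδ _ => ?_
    obtain ⟨K, hK, hle⟩ := exists_kernel_quadCost_le hX hDtop hD (κ₀ π₀) (κ₁ π₁)
      (δ := δ) (by exact_mod_cast hδ.ne')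
    have := isMarkovKernel_of_mem_Plans hK
    obtain ⟨e₀, e₁⟩ := map_compProd_of_mem_Plans (h₀ π₀ hπ₀) (h₁ π₁ hπ₁) hK
    calc ⨅ γ ∈ Competitors ν μ₀ μ₁, nuCost γ
        ≤ nuCost (ν ⊗ₘ K) := iInf₂_le _ ⟨e₀.symm ▸ hπ₀, e₁.symm ▸ hπ₁⟩
      _ ≤ ∫⁻ y, W2 (κ₀ π₀ y) (κ₁ π₁ y) ^ 2 + δ ∂ν := by
          rw [nuCost_compProd]; exact lintegral_mono hle
      _ = _ := by
          rw [lintegral_add_right _ measurable_const, lintegral_const, measure_univ, mul_one]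
  · obtain ⟨K, _, rfl, hK⟩ := exists_disintegration_mem_Plans
      (Competitors_subset_Plans3 _ _ _ hγ) (h₀ _ hγ.1) (h₁ _ hγ.2)
    refine (iInf₂_le _ hγ.1).trans ((iInf₂_le _ hγ.2).trans ?_)
    rw [nuCost_compProd]
    refine lintegral_mono_ae ?_
    filter_upwards [hK] with y hy
    rw [W2_sq]
    exact iInf₂_le _ hy

end Metric

/-! ### Limits of multi-marginal minimizers -/

theorem tendsto_lintegral_of_continuous_of_le {Ω ι : Type*} [TopologicalSpace Ω]
    [MeasurableSpace Ω] [OpensMeasurableSpace Ω] {l : Filter ι} {γ : ι → ProbabilityMeasure Ω}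
    {γbar : ProbabilityMeasure Ω} (h : Tendsto γ l (𝓝 γbar)) {F : Ω → ℝ≥0∞} (hF : Continuous F)
    {B : ℝ≥0∞} (hB : B ≠ ⊤) (hFB : ∀ p, F p ≤ B) :
    Tendsto (fun i => ∫⁻ p, F p ∂(γ i : Measure Ω)) l (𝓝 (∫⁻ p, F p ∂(γbar : Measure Ω))) := by
  have htop : ∀ p, F p ≠ ⊤ := fun p => ne_top_of_le_ne_top hB (hFB p)
  have hle : ∀ p, (F p).toNNReal ≤ B.toNNReal := fun p => ENNReal.toNNReal_mono hB (hFB p)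
  let f : BoundedContinuousFunction Ω NNReal :=
    ⟨⟨fun p => (F p).toNNReal, ENNReal.continuousOn_toNNReal.comp_continuous hF htop⟩,
      B.toNNReal, fun p q => by
        rw [NNReal.dist_eq]
        exact abs_sub_le_of_nonneg_of_le (NNReal.coe_nonneg _) (NNReal.coe_le_coe.2 (hle p))
          (NNReal.coe_nonneg _) (NNReal.coe_le_coe.2 (hle q))⟩
  have hf : ∀ p, (f p : ℝ≥0∞) = F p := fun p => ENNReal.coe_toNNReal (htop p)
  simpa only [hf] using
    (ProbabilityMeasure.tendsto_iff_forall_lintegral_tendsto.1 h) f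

variable {X : Type*} [MetricSpace X] [MeasurableSpace X]

/-- The cost of the two projections of a coupling on its base. -/
noncomputable def baseCost (γ : Measure (X × X × X)) : ℝ≥0∞ :=
  quadCost (γ.map fun p => (p.1, p.2.1)) + quadCost (γ.map fun p => (p.1, p.2.2))

/-- Each of the two terms is minimal separately. The converse, `mem_Competitors_of_baseCost_le`,
needs gluing. -/
theorem baseCost_le_of_mem_Competitors {ν μ₀ μ₁ : Measure X} {γ γ' : Measure (X × X × X)}
    (hγ : γ ∈ Competitors ν μ₀ μ₁) (hγ' : γ' ∈ Plans3 ν μ₀ μ₁) : baseCost γ ≤ baseCost γ' :=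
  add_le_add (hγ.1.2 _ (mem_Plans3_iff.1 hγ').1) (hγ.2.2 _ (mem_Plans3_iff.1 hγ').2)

variable [SecondCountableTopology X]

theorem quadCost_map [OpensMeasurableSpace X] {f g : X × X × X → X} (hf : Measurable f)
    (hg : Measurable g) (γ : Measure (X × X × X)) :
    quadCost (γ.map fun p => (f p, g p)) = ∫⁻ p, edist (f p) (g p) ^ 2 ∂γ :=
  lintegral_map (f := fun q : X × X => edist q.1 q.2 ^ 2) (by fun_prop) (by fun_prop)

theorem mmCost_eq [OpensMeasurableSpace X] (ε : ℝ) (γ : Measure (X × X × X)) :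
    mmCost ε γ = ENNReal.ofReal ε * nuCost γ + baseCost γ := by
  rw [mmCost, nuCost, baseCost, quadCost_map (by fun_prop) (by fun_prop),
    quadCost_map (by fun_prop) (by fun_prop), lintegral_add_right _ (by fun_prop),
    lintegral_add_right _ (by fun_prop), lintegral_const_mul _ (by fun_prop), add_assoc]
  simp_rw [edist_comm]

theorem baseCost_eq_lintegral [OpensMeasurableSpace X] (γ : Measure (X × X × X)) :
    baseCost γ = ∫⁻ p, (edist p.1 p.2.1 ^ 2 + edist p.1 p.2.2 ^ 2) ∂γ := by
  rw [baseCost, quadCost_map (by fun_prop) (by fun_prop),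
    quadCost_map (by fun_prop) (by fun_prop), lintegral_add_right _ (by fun_prop)]

/-- Push-forward by a continuous map is weakly continuous, and weak limits on `X` are unique. -/
theorem map_eq_of_tendsto [BorelSpace X] {ι : Type*} {l : Filter ι} [l.NeBot]
    {γ : ι → ProbabilityMeasure (X × X × X)} {γbar : ProbabilityMeasure (X × X × X)}
    (h : Tendsto γ l (𝓝 γbar)) {f : X × X × X → X} (hf : Continuous f) {μ : Measure X}
    [IsProbabilityMeasure μ] (hμ : ∀ᶠ i in l, (γ i : Measure (X × X × X)).map f = μ) :
    (γbar : Measure (X × X × X)).map f = μ := by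
  have h1 := ((ProbabilityMeasure.continuous_map hf).tendsto γbar).comp h
  let μ' : ProbabilityMeasure X := ⟨μ, inferInstance⟩
  have h2 : Tendsto (fun i => (γ i).map hf.measurable.aemeasurable) l (𝓝 μ') := by
    refine tendsto_const_nhds.congr' ?_
    filter_upwards [hμ] with i hi
    exact Subtype.ext hi.symm
  have h3 := tendsto_nhds_unique h1 h2
  exact congrArg Subtype.val h3

theorem mem_Plans3_of_tendsto [BorelSpace X] {ι : Type*} {l : Filter ι} [l.NeBot]
    {γ : ι → ProbabilityMeasure (X × X × X)} {γbar : ProbabilityMeasure (X × X × X)}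
    (h : Tendsto γ l (𝓝 γbar)) {ν μ₀ μ₁ : Measure X} [IsProbabilityMeasure ν]
    [IsProbabilityMeasure μ₀] [IsProbabilityMeasure μ₁]
    (hγ : ∀ᶠ i in l, (γ i : Measure (X × X × X)) ∈ Plans3 ν μ₀ μ₁) :
    (γbar : Measure (X × X × X)) ∈ Plans3 ν μ₀ μ₁ :=
  ⟨map_eq_of_tendsto h (by fun_prop) (hγ.mono fun _ hi => hi.1),
    map_eq_of_tendsto h (by fun_prop) (hγ.mono fun _ hi => hi.2.1),
    map_eq_of_tendsto h (by fun_prop) (hγ.mono fun _ hi => hi.2.2)⟩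

/-- A coupling whose base cost is minimal projects to optimal plans. -/
theorem mem_Competitors_of_baseCost_le [StandardBorelSpace X] [OpensMeasurableSpace X]
    {D : ℝ≥0∞} (hDtop : D ≠ ⊤)
    (hD : ∀ x x' : X, edist x x' ≤ D) {ν μ₀ μ₁ : Measure X} [IsProbabilityMeasure ν]
    {γ : Measure (X × X × X)} (hγ : γ ∈ Plans3 ν μ₀ μ₁)
    (hmin : ∀ γ' ∈ Plans3 ν μ₀ μ₁, baseCost γ ≤ baseCost γ') : γ ∈ Competitors ν μ₀ μ₁ := by
  obtain ⟨h₀, h₁⟩ := mem_Plans3_iff.1 hγ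
  have hfin : ∀ {μ : Measure X} {π : Measure (X × X)}, π ∈ Plans ν μ → quadCost π ≠ ⊤ := by
    intro μ π hπ
    have := isProbabilityMeasure_of_mem_Plans hπ
    exact ne_top_of_le_ne_top (by finiteness) (quadCost_le hD π)
  refine ⟨⟨h₀, fun π hπ => ?_⟩, ⟨h₁, fun π hπ => ?_⟩⟩
  -- The glued coupling changes only the first projection, so the finite cost of the second cancels.
  · obtain ⟨γ', e₀, e₁⟩ := exists_glued_plan hπ h₁
    have := hmin γ' (mem_Plans3_iff.2 ⟨e₀.symm ▸ hπ, e₁.symm ▸ h₁⟩)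
    rw [baseCost, baseCost, e₀, e₁] at this
    exact (ENNReal.add_le_add_iff_right (hfin h₁)).1 this
  · obtain ⟨γ', e₀, e₁⟩ := exists_glued_plan h₀ hπ
    have := hmin γ' (mem_Plans3_iff.2 ⟨e₀.symm ▸ h₀, e₁.symm ▸ hπ⟩)
    rw [baseCost, baseCost, e₀, e₁] at this
    exact (ENNReal.add_le_add_iff_left (hfin h₀)).1 this

/-- Limits, as `ε → 0⁺`, of minimizers of the multi-marginal problem are optimal in the definition
of the `ν`-based Wasserstein metric. -/
theorem mem_NuOptimal_of_tendsto [StandardBorelSpace X] [BorelSpace X] {D : ℝ≥0∞} (hDtop : D ≠ ⊤)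
    (hD : ∀ x x' : X, edist x x' ≤ D) {ν μ₀ μ₁ : Measure X} [IsProbabilityMeasure ν]
    [IsProbabilityMeasure μ₀] [IsProbabilityMeasure μ₁] {ι : Type*} {l : Filter ι} [l.NeBot]
    {ε : ι → ℝ} {γ : ι → ProbabilityMeasure (X × X × X)} {γbar : ProbabilityMeasure (X × X × X)}
    (hε : Tendsto ε l (𝓝[>] 0))
    (hopt : ∀ᶠ i in l, (γ i : Measure (X × X × X)) ∈ MMOptimal (ε i) ν μ₀ μ₁)
    (h : Tendsto γ l (𝓝 γbar)) : (γbar : Measure (X × X × X)) ∈ NuOptimal ν μ₀ μ₁ := by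
  obtain ⟨hε0, hεpos⟩ := tendsto_nhdsWithin_iff.1 hε
  have hbase : Tendsto (fun i => baseCost (γ i : Measure (X × X × X))) l (𝓝 (baseCost γbar.1)) := by
    simp_rw [baseCost_eq_lintegral]
    exact tendsto_lintegral_of_continuous_of_le h (by fun_prop) (B := D ^ 2 + D ^ 2)
      (by finiteness) fun p => by gcongr <;> exact hD _ _
  have hnu : Tendsto (fun i => nuCost (γ i : Measure (X × X × X))) l (𝓝 (nuCost γbar.1)) :=
    tendsto_lintegral_of_continuous_of_le h (by fun_prop) (B := D ^ 2)
      (by finiteness) fun p => by gcongr; exact hD _ _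
  have hnu_le : ∀ γ' : Measure (X × X × X), γ' ∈ Plans3 ν μ₀ μ₁ → nuCost γ' ≤ D ^ 2 := by
    intro γ' hγ'
    have hp : γ'.map (fun p => p.1) = ν := hγ'.1
    have : γ' Set.univ = 1 := by
      rw [← Set.preimage_univ (f := fun p : X × X × X => p.1),
        ← Measure.map_apply measurable_fst MeasurableSet.univ, hp, measure_univ]
    calc nuCost γ' ≤ ∫⁻ _, D ^ 2 ∂γ' := lintegral_mono fun p => by gcongr; exact hD _ _
      _ = D ^ 2 := by rw [lintegral_const, this, mul_one]
  have hmem : γbar.1 ∈ Plans3 ν μ₀ μ₁ := mem_Plans3_of_tendsto h (hopt.mono fun _ hi => hi.1)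
  refine ⟨mem_Competitors_of_baseCost_le hDtop hD hmem fun γ' hγ' => ?_, fun γ' hγ' => ?_⟩
  -- On the competing side the `ε`-term vanishes in the limit because `nuCost γ'` is finite; on the
  -- minimizing side it is nonnegative and is dropped.
  · have hlim : Tendsto (fun i => ENNReal.ofReal (ε i) * nuCost γ' + baseCost γ') l
        (𝓝 (ENNReal.ofReal 0 * nuCost γ' + baseCost γ')) :=
      (ENNReal.Tendsto.mul_const (ENNReal.tendsto_ofReal hε0)
        (Or.inr (ne_top_of_le_ne_top (by finiteness) (hnu_le γ' hγ')))).add tendsto_const_nhds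
    rw [ENNReal.ofReal_zero, zero_mul, zero_add] at hlim
    refine le_of_tendsto_of_tendsto hbase hlim ?_
    filter_upwards [hopt] with i hi
    have := hi.2 γ' hγ'
    rw [mmCost_eq, mmCost_eq] at this
    exact le_add_self.trans this
  -- Already before the limit `nuCost (γ i) ≤ nuCost γ'`: as `baseCost γ' ≤ baseCost (γ i)`, the
  -- base costs cancel in the optimality of `γ i`, and `ε i > 0` divides out.
  · refine le_of_tendsto hnu ?_
    filter_upwards [hopt, hεpos] with i hi hpos
    have hγ3 := Competitors_subset_Plans3 _ _ _ hγ'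
    have hle := hi.2 γ' hγ3
    rw [mmCost_eq, mmCost_eq] at hle
    have hb := baseCost_le_of_mem_Competitors hγ' hi.1
    have hfin : baseCost (γ i : Measure (X × X × X)) ≠ ⊤ := by
      rw [baseCost_eq_lintegral]
      refine ne_top_of_le_ne_top (b := D ^ 2 + D ^ 2) (by finiteness) ?_
      calc _ ≤ ∫⁻ _, D ^ 2 + D ^ 2 ∂(γ i : Measure (X × X × X)) :=
            lintegral_mono fun p => by gcongr <;> exact hD _ _
        _ = _ := by simp
    have h2 := (ENNReal.add_le_add_iff_right hfin).1 (hle.trans (by gcongr))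
    exact (ENNReal.mul_le_mul_iff_right (ENNReal.ofReal_pos.2 hpos).ne' ENNReal.ofReal_ne_top).1 h2

end BaseWasserstein

theorem mainTheorem1 (m : ℕ) (X : Set (EuclideanSpace ℝ (Fin m)))
    (hX : MeasurableSet X) (hconv : Convex ℝ X) (hbdd : Bornology.IsBounded X)
    (ν μ₀ μ₁ : Measure X)
    [IsProbabilityMeasure ν] [IsProbabilityMeasure μ₀] [IsProbabilityMeasure μ₁] :
    -- (1) for any choice of the conditional probabilities of the optimal plans
    (∀ κ₀ κ₁ : Measure (X × X) → Kernel X X,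
      (∀ π ∈ BaseWasserstein.OptPlans ν μ₀, BaseWasserstein.IsDisintegration ν π (κ₀ π)) →
      (∀ π ∈ BaseWasserstein.OptPlans ν μ₁, BaseWasserstein.IsDisintegration ν π (κ₁ π)) →
      (∀ π₀ ∈ BaseWasserstein.OptPlans ν μ₀, ∀ π₁ ∈ BaseWasserstein.OptPlans ν μ₁,
        AEMeasurable (fun y => BaseWasserstein.W2 (κ₀ π₀ y) (κ₁ π₁ y) ^ 2) ν) ∧
      BaseWasserstein.Wnu ν μ₀ μ₁ ^ 2 =
        ⨅ π₀ ∈ BaseWasserstein.OptPlans ν μ₀, ⨅ π₁ ∈ BaseWasserstein.OptPlans ν μ₁,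
          ∫⁻ y, BaseWasserstein.W2 (κ₀ π₀ y) (κ₁ π₁ y) ^ 2 ∂ν) ∧
    -- (2) for any family of minimizers, along any index filter on which `ε → 0⁺`
    (∀ (ι : Type) (l : Filter ι) (ε : ι → ℝ) (γ : ι → ProbabilityMeasure (X × X × X))
      (γbar : ProbabilityMeasure (X × X × X)),
      Tendsto ε l (𝓝[>] 0) →
      (∀ᶠ i in l, (γ i : Measure (X × X × X)) ∈ BaseWasserstein.MMOptimal (ε i) ν μ₀ μ₁) →
      MapClusterPt γbar l γ →
      (γbar : Measure (X × X × X)) ∈ BaseWasserstein.NuOptimal ν μ₀ μ₁) := by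
  have : StandardBorelSpace X := hX.standardBorel
  obtain ⟨D, hD⟩ := Metric.isBounded_iff.1 hbdd
  have hD' : ∀ x x' : X, edist x x' ≤ ENNReal.ofReal D := by
    intro x x'
    rw [edist_dist]
    exact ENNReal.ofReal_le_ofReal (hD x.2 x'.2)
  have htb : TotallyBounded (Set.univ : Set X) := by
    rw [← totallyBounded_image_iff isUniformEmbedding_subtype_val.isUniformInducing]
    exact hbdd.isCompact_closure.totallyBounded.subset (by simpa using subset_closure)
  refine ⟨fun κ₀ κ₁ h₀ h₁ => ⟨fun π₀ hπ₀ π₁ hπ₁ => ?_, ?_⟩, fun ι l ε γ γbar hε hopt hcl => ?_⟩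
  · have := (h₀ π₀ hπ₀).1
    have := (h₁ π₁ hπ₁).1
    exact (BaseWasserstein.measurable_W2_sq htb ENNReal.ofReal_ne_top hD' _ _).aemeasurable
  · exact BaseWasserstein.Wnu_sq_eq_iInf_lintegral_W2_sq htb ENNReal.ofReal_ne_top hD' ν μ₀ μ₁ h₀ h₁
  -- A cluster point is a limit along an ultrafilter finer than `l`, to which the hypotheses on `ε`
  -- and `γ` pass.
  · obtain ⟨u, hul, hu⟩ := mapClusterPt_iff_ultrafilter.1 hcl
    exact BaseWasserstein.mem_NuOptimal_of_tendsto ENNReal.ofReal_ne_top hD' (hε.mono_left hul)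
      (hul hopt) hu
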